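/- **Theorem 5 (Generalization bound for $H^k$).** There is a function $r=r(n,\xi,B,\tilde B,c,I,\delta)$ of natural numbers $n,\xi,I$ and real numbers $B,\tilde B,c,\delta$, with $r(n,\xi,B,\tilde B,c,I,\delta)\to0$ as $I\to\infty$ for all fixed $n,\xi,c$, $B,\tilde B>0$ and $\delta\in(0,1)$, such that the following holds for all $N,k\in\mathbb N$. Let $P$ be a probability measure on $[0,2\pi]^N$ with a bounded density with respect to Lebesgue measure. Let $\Omega\subset\mathbb R^N$ be a finite set of frequencies, divided into disjoint parts $\Omega=\Omega_+\cup\Omega_-\cup\{0\}$ such that $-\omega\in\Omega_-$ for every $\omega\in\Omega_+$. For $B>0$ let $\mathcal F_\Omega^B$ be the set of real-valued functions $f(x)=\sum_{\omega\in\Omega}c_\omega e^{-i\omega\cdot x}$ on $[0,2\pi]^N$, $c_\omega\in\mathbb C$, with $\sup_{x\in[0,2\pi]^N}|f(x)|\le B$. For $\tilde B>0$ let $\mathcal H_\Omega^{\tilde B}$ be the set of functions $\frac{a_0}2+\sum_{\omega\in\Omega_+}(a_\omega\cos(\omega\cdot x)+b_\omega\sin(\omega\cdot x))$ with real coefficients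 such that $\big(a_0^2+\sum_{\omega\in\Omega_+}(a_\omega^2+b_\omega^2)\big)^{1/2}\le\tilde B$. Assume that $\mathcal F_\Omega^B\subseteq\mathcal H_\Omega^{\tilde B}$. Let $\mathcal F\subseteq H^k([0,2\pi]^N)$ be a set of target functions, where $H^k([0,2\pi]^N)$ consists of the real functions in $L^2([0,2\pi]^N)$ whose weak derivatives $D^\alpha$, $|\alpha|\le k$, on $(0,2\pi)^N$ are in $L^2$; for every element of $\mathcal F$ fix representatives of these derivatives, while for the smooth functions in $\mathcal F_\Omega^B$ the $D^\alpha$ are the classical derivatives. Put $$\ell_{h^k}(f_1(x),f_2(x))=\sum_{|\alpha|\le k}\big(D^\alpha f_1(x)-D^\alpha f_2(x)\big)^2,$$ and assume that $\ell_{h^k}(f_1(x),f_2(x))\le c$ for almost every $x\in[0,2\pi]^N$, for all $f_1,f_2\in\mathcal F_\Omega^B\cup\mathcal F$. Let $\xi$ be the number of multi-indices $\alpha\in\mathbb N^N$ with $|\alpha|\le k$ (the function value $\alpha=0$ included). Then for every $f^*\in\mathcal F$, every $\delta\in(0,1)$ and every $I\ge1$, with probability at least $1-\delta$ over i.i.d.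 points $x^1,\dots,x^I$ with law $P$, all $f\in\mathcal F_\Omega^B$ satisfy simultaneously $$D_{H^k}(f^*,f)\le D_{h^k}(f^*,f)+r(|\Omega|,\xi,B,\tilde B,c,I,\delta),$$ where $$D_{H^k}(f^*,f)=\Big(\sum_{|\alpha|\le k}\int\big(D^\alpha f^*-D^\alpha f\big)^2\,dP\Big)^{1/2},\qquad D_{h^k}(f^*,f)=\Big(\frac1I\sum_{i=1}^I\ell_{h^k}\big(f^*(x^i),f(x^i)\big)\Big)^{1/2}.$$ -/

import Mathlib

open MeasureTheory Filter Topology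

noncomputable section

/-- The closed cube `[0, 2π]^N`. -/
def closedCube (N : ℕ) : Set (Fin N → ℝ) := Set.univ.pi fun _ => Set.Icc 0 (2 * Real.pi)

/-- The open cube `(0, 2π)^N`. -/
def openCube (N : ℕ) : Set (Fin N → ℝ) := Set.univ.pi fun _ => Set.Ioo 0 (2 * Real.pi)

/-- The finite set of multi-indices `α ∈ ℕ^N` with `|α| = ∑ i, α i ≤ k`. -/
def multiIndices (N k : ℕ) : Finset (Fin N → ℕ) :=
  (Fintype.piFinset fun _ => Finset.range (k + 1)).filter fun α => ∑ i, α i ≤ k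

theorem mem_multiIndices {N k : ℕ} {α : Fin N → ℕ} :
    α ∈ multiIndices N k ↔ ∑ i, α i ≤ k := by
  simp only [multiIndices, Finset.mem_filter, Fintype.mem_piFinset, Finset.mem_range,
    and_iff_right_iff_imp]
  intro h i
  exact Nat.lt_succ_of_le
    ((Finset.single_le_sum (f := α) (fun j _ => Nat.zero_le _) (Finset.mem_univ i)).trans h)

/-- The classical partial derivative `∂f/∂x_i`. -/
def partialDeriv {N : ℕ} (i : Fin N) (f : (Fin N → ℝ) → ℝ) : (Fin N → ℝ) → ℝ :=
  fun x => fderiv ℝ f x (Pi.single i 1)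

/-- The classical derivative `D^α f = ∂^{|α|} f / ∂x_1^{α_1} ⋯ ∂x_N^{α_N}`. -/
def multiDeriv {N : ℕ} (α : Fin N → ℕ) (f : (Fin N → ℝ) → ℝ) : (Fin N → ℝ) → ℝ :=
  (List.finRange N).foldr (fun i g => (partialDeriv i)^[α i] g) f

/-- `g` is a weak derivative `D^α u` of `u` on the cube: `∫ u D^α φ = (-1)^{|α|} ∫ g φ` for all
test functions `φ ∈ C_c^∞((0, 2π)^N)`. (It is used for square-integrable `u` and `g` only.) -/
def IsWeakMultiDeriv {N : ℕ} (α : Fin N → ℕ) (u g : (Fin N → ℝ) → ℝ) : Prop :=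
  ∀ φ : (Fin N → ℝ) → ℝ, ContDiff ℝ (⊤ : ℕ∞) φ → HasCompactSupport φ → tsupport φ ⊆ openCube N →
    ∫ x in openCube N, u x * multiDeriv α φ x
      = (-1) ^ (∑ i, α i) * ∫ x in openCube N, g x * φ x

/-- A function on the cube together with its partial derivatives: `u α x` is the value
`D^α u (x)`, and `u 0` is the function itself. -/
abbrev DerivFamily (N : ℕ) : Type := (Fin N → ℕ) → (Fin N → ℝ) → ℝ

/-- `u` represents an element of `H^k([0, 2π]^N)`: `u 0` is square integrable, and for every
`|α| ≤ k` the function `u α` is a square integrable weak derivative `D^α (u 0)`. Elements of `H^k`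
and their weak derivatives are classes modulo null sets; `u` also records which representatives
are evaluated at sample points. -/
def MemSobolev {N : ℕ} (k : ℕ) (u : DerivFamily N) : Prop :=
  ∀ α ∈ multiIndices N k,
    MemLp (u α) 2 (volume.restrict (openCube N)) ∧ IsWeakMultiDeriv α (u 0) (u α)

/-- A smooth function together with its classical partial derivatives. -/
def classicalFamily {N : ℕ} (f : (Fin N → ℝ) → ℝ) : DerivFamily N := fun α => multiDeriv α f

/-- The finite frequency set `Ω` is the disjoint union `Ω₊ ∪ Ω₋ ∪ {0}`, with `-ω ∈ Ω₋` for every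
`ω ∈ Ω₊`. -/
def IsFrequencySplit {N : ℕ} (Ω Ωplus Ωminus : Finset (Fin N → ℝ)) : Prop :=
  (∀ ω, ω ∈ Ω ↔ ω ∈ Ωplus ∨ ω ∈ Ωminus ∨ ω = 0) ∧
  Disjoint Ωplus Ωminus ∧ 0 ∉ Ωplus ∧ 0 ∉ Ωminus ∧ ∀ ω ∈ Ωplus, -ω ∈ Ωminus

/-- `F_Ω^B`: the real-valued functions `f(x) = ∑_{ω ∈ Ω} c_ω exp(-i ω x)` with complex
coefficients and `|f| ≤ B` on `[0, 2π]^N`. Such a function is determined by its restriction to the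
cube, so the elements are written as functions on the whole space, given by the same formula. -/
def trigClass {N : ℕ} (Ω : Finset (Fin N → ℝ)) (B : ℝ) : Set ((Fin N → ℝ) → ℝ) :=
  {f | (∃ c : (Fin N → ℝ) → ℂ,
      ∀ x, (f x : ℂ) = ∑ ω ∈ Ω, c ω * Complex.exp (-(Complex.I * ((ω ⬝ᵥ x : ℝ) : ℂ)))) ∧
    ∀ x ∈ closedCube N, |f x| ≤ B}

/-- `H_Ω^{B'}`: the functions `f(x) = a₀ / 2 + ∑_{ω ∈ Ω₊} (a_ω cos(ω x) + b_ω sin(ω x))` with real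
coefficients and `(a₀² + ∑_{ω ∈ Ω₊} (a_ω² + b_ω²))^{1/2} ≤ B'`. -/
def coeffClass {N : ℕ} (Ωplus : Finset (Fin N → ℝ)) (B' : ℝ) : Set ((Fin N → ℝ) → ℝ) :=
  {f | ∃ (a₀ : ℝ) (a b : (Fin N → ℝ) → ℝ),
    (∀ x, f x = a₀ / 2 + ∑ ω ∈ Ωplus, (a ω * Real.cos (ω ⬝ᵥ x) + b ω * Real.sin (ω ⬝ᵥ x))) ∧
    √(a₀ ^ 2 + ∑ ω ∈ Ωplus, (a ω ^ 2 + b ω ^ 2)) ≤ B'}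

/-- `P` has a bounded density with respect to the Lebesgue measure on the cube. -/
def HasBoundedDensity {N : ℕ} (P : Measure (Fin N → ℝ)) : Prop :=
  ∃ p : (Fin N → ℝ) → ℝ, Measurable p ∧ (∀ x, 0 ≤ p x) ∧ (∃ M, ∀ x, p x ≤ M) ∧
    P = (volume.restrict (closedCube N)).withDensity fun x => ENNReal.ofReal (p x)

/-- The loss `ℓ_{h^k}(u(x), v(x)) = ∑_{|α| ≤ k} (D^α u(x) - D^α v(x))²`. -/
def sobolevLoss {N : ℕ} (k : ℕ) (u v : DerivFamily N) (x : Fin N → ℝ) : ℝ :=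
  ∑ α ∈ multiIndices N k, (u α x - v α x) ^ 2

/-- The target distance
`D_{H^k}(u, v) = (∑_{|α| ≤ k} ∫ (D^α u - D^α v)² dP)^{1/2}`. -/
def sobolevDist {N : ℕ} (k : ℕ) (P : Measure (Fin N → ℝ)) (u v : DerivFamily N) : ℝ :=
  √(∑ α ∈ multiIndices N k, ∫ x, (u α x - v α x) ^ 2 ∂P)

/-- The empirical risk `D_{h^k}(u, v) = (I⁻¹ ∑_i ℓ_{h^k}(u(x^i), v(x^i)))^{1/2}` on the sample
`S = (x^i)_{i < I}`. -/
def empiricalSobolevDist {N I : ℕ} (k : ℕ) (S : Fin I → Fin N → ℝ) (u v : DerivFamily N) : ℝ :=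
  √((1 / (I : ℝ)) * ∑ i, sobolevLoss k u v (S i))

end

/-! The bound is uniform over `f` because only finitely many random quantities matter.
Differentiating a trigonometric sum keeps its frequencies, so `D^α f` is a combination of the fixed
functions 1/2, cos, sin. Comparing with the zero function, the loss bound gives `|D^α f| ≤ √c` on
the cube; rescaled to have values at most `B`, the derivative falls under the inclusion `trigClass ⊆
coeffClass`, which bounds its coefficients (`exists_coeff_multiDeriv`).

Hence `(D^α f* - D^α f)²` is a quadratic form, with bounded coefficients, in products of functions
chosen independently of `f`: those above and `D^α f*`. Chebyshev and a union bound control all these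
products on one event (`exists_event_empirical_mean_deviation_le`), and
`integral_sq_sum_le_empirical_mean` transfers this to every `f`. Summing over `α` and using
subadditivity of the square root gives the claim. -/

/-! ### Concentration of empirical means -/

section Concentration

variable {X κ : Type*} [MeasurableSpace X] [Fintype κ]

/-- Chebyshev's inequality for the empirical mean of a bounded function. -/
theorem measure_empirical_mean_deviation_le (P : Measure X) [IsProbabilityMeasure P] {F : X → ℝ}
    (hF : AEStronglyMeasurable F P) {M : ℝ} (hM : ∀ᵐ x ∂P, |F x| ≤ M) {I : ℕ} (hI : 1 ≤ I)
    {t : ℝ} (ht : 0 < t) :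
    (Measure.pi fun _ : Fin I => P) {S | t ≤ |1 / (I : ℝ) * ∑ i, F (S i) - ∫ x, F x ∂P|}
      ≤ ENNReal.ofReal (M ^ 2 / (I * t ^ 2)) := by
  have hI0 : (0 : ℝ) < I := by exact_mod_cast hI
  have hL : MemLp F 2 P := MemLp.of_bound hF M (by simpa using hM)
  have hLi : ∀ i : Fin I, MemLp (fun S : Fin I → X => F (S i)) 2 (Measure.pi fun _ => P) :=
    fun i => hL.comp_measurePreserving (measurePreserving_eval (fun _ : Fin I => P) i)
  have hsum : MemLp (∑ i : Fin I, fun S : Fin I → X => F (S i)) 2 (Measure.pi fun _ => P) :=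
    memLp_finsetSum' _ fun i _ => hLi i
  have hmean : ∫ S, (∑ i : Fin I, fun S : Fin I → X => F (S i)) S ∂(Measure.pi fun _ => P)
      = I * ∫ x, F x ∂P := by
    simp only [Finset.sum_apply]
    rw [integral_finsetSum _ fun i _ => (hLi i).integrable (by norm_num)]
    have : ∀ i : Fin I, ∫ S : Fin I → X, F (S i) ∂(Measure.pi fun _ => P) = ∫ x, F x ∂P :=
      fun i => integral_comp_eval (μ := fun _ : Fin I => P) hF
    simp [this]
  have hvar : ProbabilityTheory.variance (∑ i : Fin I, fun S : Fin I → X => F (S i))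
      (Measure.pi fun _ => P) ≤ I * M ^ 2 := by
    rw [ProbabilityTheory.variance_sum_pi (μ := fun _ : Fin I => P) (X := fun _ => F)
      fun _ => hL]
    -- Popoviciu's inequality: values in `[-M, M]` give variance at most `M²`.
    have h1 := ProbabilityTheory.variance_le_sq_of_bounded (μ := P) (a := -M) (b := M) (X := F)
      (hM.mono fun x hx => abs_le.mp hx) hF.aemeasurable
    have h2 : ((M - -M) / 2) ^ 2 = M ^ 2 := by ring
    rw [h2] at h1
    simpa using mul_le_mul_of_nonneg_left h1 hI0.le
  have hc := ProbabilityTheory.meas_ge_le_variance_div_sq hsum (mul_pos hI0 ht)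
  rw [hmean] at hc
  refine (measure_mono fun S hS => ?_).trans (hc.trans (ENNReal.ofReal_le_ofReal ?_))
  · simp only [Set.mem_ofPred_eq, Finset.sum_apply] at hS ⊢
    have : ∑ i, F (S i) - I * ∫ x, F x ∂P
        = I * (1 / (I : ℝ) * ∑ i, F (S i) - ∫ x, F x ∂P) := by
      field_simp
    rw [this, abs_mul, abs_of_pos hI0]
    exact mul_le_mul_of_nonneg_left hS hI0.le
  · calc _ ≤ I * M ^ 2 / (I * t) ^ 2 := by gcongr
      _ = M ^ 2 / (I * t ^ 2) := by field_simp

/-- Simultaneous concentration of the empirical means of finitely many bounded functions. -/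
theorem exists_event_empirical_mean_deviation_le (P : Measure X) [IsProbabilityMeasure P]
    {F : κ → X → ℝ} (hF : ∀ k, AEStronglyMeasurable (F k) P) {M : ℝ}
    (hM : ∀ k, ∀ᵐ x ∂P, |F k x| ≤ M) {I : ℕ} (hI : 1 ≤ I) {t δ : ℝ} (ht : 0 < t)
    (hδ : Fintype.card κ * (M ^ 2 / (I * t ^ 2)) ≤ δ) :
    ∃ G : Set (Fin I → X), MeasurableSet G ∧
      ENNReal.ofReal (1 - δ) ≤ (Measure.pi fun _ : Fin I => P) G ∧
      ∀ S ∈ G, ∀ k, |1 / (I : ℝ) * ∑ i, F k (S i) - ∫ x, F k x ∂P| ≤ t := by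
  set μ := Measure.pi fun _ : Fin I => P
  let bad : κ → Set (Fin I → X) :=
    fun k => {S | t ≤ |1 / (I : ℝ) * ∑ i, F k (S i) - ∫ x, F k x ∂P|}
  have hbad : μ (⋃ k, bad k) ≤ ENNReal.ofReal δ := by
    have h0 : 0 ≤ M ^ 2 / (I * t ^ 2) := by positivity
    calc μ (⋃ k, bad k) ≤ ∑ k, μ (bad k) := measure_iUnion_fintype_le _ _
      _ ≤ ∑ _k : κ, ENNReal.ofReal (M ^ 2 / (I * t ^ 2)) :=
        Finset.sum_le_sum fun k _ => measure_empirical_mean_deviation_le P (hF k) (hM k) hI ht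
      _ = ENNReal.ofReal (Fintype.card κ * (M ^ 2 / (I * t ^ 2))) := by
        rw [ENNReal.ofReal_mul (by positivity)]
        simp
      _ ≤ ENNReal.ofReal δ := ENNReal.ofReal_le_ofReal hδ
  have hδ0 : 0 ≤ δ := le_trans (by positivity) hδ
  -- The `F k` are only a.e. strongly measurable, so the bad set is replaced by a measurable hull of
  -- equal measure.
  refine ⟨(toMeasurable μ (⋃ k, bad k))ᶜ, (measurableSet_toMeasurable _ _).compl, ?_, ?_⟩
  · rw [prob_compl_eq_one_sub (measurableSet_toMeasurable _ _), measure_toMeasurable,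
      ENNReal.ofReal_sub _ hδ0, ENNReal.ofReal_one]
    exact tsub_le_tsub_left hbad 1
  · intro S hS k
    by_contra h
    exact hS (subset_toMeasurable _ _ (Set.mem_iUnion.mpr ⟨k, (not_le.mp h).le⟩))

end Concentration

/-- If the products `ψ j * ψ l` have empirical means within `t` of their expectations, the square
of a linear combination of the `ψ j` with coefficients bounded by `K` has expectation at most its
empirical mean plus `t (|ι| K)²`. -/
theorem integral_sq_sum_le_empirical_mean {X ι : Type*} [MeasurableSpace X] [Fintype ι]
    (P : Measure X) {ψ : ι → X → ℝ} (hψ : ∀ j l, Integrable (fun x => ψ j x * ψ l x) P)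
    {η : ι → ℝ} {K : ℝ} (hη : ∀ j, |η j| ≤ K) {I : ℕ} (S : Fin I → X) {t : ℝ}
    (hS : ∀ j l, |1 / (I : ℝ) * ∑ i, ψ j (S i) * ψ l (S i) - ∫ x, ψ j x * ψ l x ∂P| ≤ t) :
    ∫ x, (∑ j, η j * ψ j x) ^ 2 ∂P
      ≤ 1 / (I : ℝ) * ∑ i, (∑ j, η j * ψ j (S i)) ^ 2 + t * (Fintype.card ι * K) ^ 2 := by
  have hsq : ∀ x, (∑ j, η j * ψ j x) ^ 2 = ∑ j, ∑ l, η j * η l * (ψ j x * ψ l x) := by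
    intro x
    rw [sq, Finset.sum_mul_sum]
    exact Finset.sum_congr rfl fun j _ => Finset.sum_congr rfl fun l _ => by ring
  have hint : ∫ x, (∑ j, η j * ψ j x) ^ 2 ∂P
      = ∑ j, ∑ l, η j * η l * ∫ x, ψ j x * ψ l x ∂P := by
    simp_rw [hsq]
    rw [integral_finsetSum _ fun j _ => integrable_finsetSum _ fun l _ => (hψ j l).const_mul _]
    refine Finset.sum_congr rfl fun j _ => ?_
    rw [integral_finsetSum _ fun l _ => (hψ j l).const_mul _]
    exact Finset.sum_congr rfl fun l _ => integral_const_mul _ _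
  have hemp : 1 / (I : ℝ) * ∑ i, (∑ j, η j * ψ j (S i)) ^ 2
      = ∑ j, ∑ l, η j * η l * (1 / (I : ℝ) * ∑ i, ψ j (S i) * ψ l (S i)) := by
    simp_rw [hsq]
    rw [Finset.sum_comm, Finset.mul_sum]
    refine Finset.sum_congr rfl fun j _ => ?_
    rw [Finset.sum_comm, Finset.mul_sum]
    refine Finset.sum_congr rfl fun l _ => ?_
    rw [← Finset.mul_sum]
    ring
  have hdiff : ∀ j l, η j * η l * ∫ x, ψ j x * ψ l x ∂P
      ≤ η j * η l * (1 / (I : ℝ) * ∑ i, ψ j (S i) * ψ l (S i)) + K * K * t := by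
    intro j l
    have hK : 0 ≤ K := (abs_nonneg _).trans (hη j)
    have h1 : |η j * η l * (1 / (I : ℝ) * ∑ i, ψ j (S i) * ψ l (S i) - ∫ x, ψ j x * ψ l x ∂P)|
        ≤ K * K * t := by
      rw [abs_mul, abs_mul]
      exact mul_le_mul (mul_le_mul (hη j) (hη l) (abs_nonneg _) hK) (hS j l) (abs_nonneg _)
        (mul_nonneg hK hK)
    have h2 := (abs_le.mp h1).1
    rw [mul_sub] at h2
    linarith
  rw [hint, hemp]
  calc _ ≤ ∑ j, ∑ l, (η j * η l * (1 / (I : ℝ) * ∑ i, ψ j (S i) * ψ l (S i)) + K * K * t) :=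
        Finset.sum_le_sum fun j _ => Finset.sum_le_sum fun l _ => hdiff j l
    _ = _ := by
        simp only [Finset.sum_add_distrib, Finset.sum_const, Finset.card_univ, nsmul_eq_mul]
        ring

/-! ### Trigonometric sums and their derivatives -/

/-- Real trigonometric sums `∑_{ω ∈ Ω} c_ω exp(-i ω x)`, without a bound on their values. -/
def IsRealTrigSum {N : ℕ} (Ω : Finset (Fin N → ℝ)) (f : (Fin N → ℝ) → ℝ) : Prop :=
  ∃ c : (Fin N → ℝ) → ℂ,
    ∀ x, (f x : ℂ) = ∑ ω ∈ Ω, c ω * Complex.exp (-(Complex.I * ((ω ⬝ᵥ x : ℝ) : ℂ)))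

theorem hasFDerivAt_exp_neg_I_mul_dotProduct {N : ℕ} (ω x : Fin N → ℝ) :
    ∃ L : (Fin N → ℝ) →L[ℝ] ℂ,
      HasFDerivAt (fun y : Fin N → ℝ => Complex.exp (-(Complex.I * ((ω ⬝ᵥ y : ℝ) : ℂ)))) L x ∧
      ∀ i, L (Pi.single i 1)
        = -(Complex.I * ω i) * Complex.exp (-(Complex.I * ((ω ⬝ᵥ x : ℝ) : ℂ))) := by
  let D : (Fin N → ℝ) →L[ℝ] ℝ := ∑ j, ω j • ContinuousLinearMap.proj (R := ℝ) (φ := fun _ => ℝ) j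
  have hD : ∀ y, D y = ω ⬝ᵥ y := fun y => by
    simp [D, dotProduct]
  have h1 : HasFDerivAt (fun y : Fin N → ℝ => -(Complex.I * ((ω ⬝ᵥ y : ℝ) : ℂ)))
      (-(Complex.I • Complex.ofRealCLM.comp D)) x := by
    have : HasFDerivAt (fun y : Fin N → ℝ => (-(Complex.I • Complex.ofRealCLM.comp D)) y) _ x :=
      (-(Complex.I • Complex.ofRealCLM.comp D)).hasFDerivAt
    simpa [hD] using this
  refine ⟨_, h1.cexp, fun i => ?_⟩
  simp [hD]
  ring

namespace IsRealTrigSum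

variable {N : ℕ} {Ω : Finset (Fin N → ℝ)} {f : (Fin N → ℝ) → ℝ}

theorem continuous (hf : IsRealTrigSum Ω f) : Continuous f := by
  obtain ⟨c, hc⟩ := hf
  have : f = fun x =>
      (∑ ω ∈ Ω, c ω * Complex.exp (-(Complex.I * ((ω ⬝ᵥ x : ℝ) : ℂ)))).re := by
    funext x
    rw [← hc, Complex.ofReal_re]
  rw [this]
  refine Complex.continuous_re.comp (continuous_finsetSum _ fun ω _ => continuous_const.mul ?_)
  exact Complex.continuous_exp.comp (continuous_const.mul
    (Complex.continuous_ofReal.comp (by unfold dotProduct; fun_prop))).neg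

/-- Differentiation only multiplies `c_ω` by `-i ω_i`, so no new frequency appears. -/
theorem partialDeriv (hf : IsRealTrigSum Ω f) (i : Fin N) :
    IsRealTrigSum Ω (partialDeriv i f) := by
  obtain ⟨c, hc⟩ := hf
  refine ⟨fun ω => c ω * -(Complex.I * ω i), fun x => ?_⟩
  choose L hL hLi using fun ω => hasFDerivAt_exp_neg_I_mul_dotProduct ω x
  have hsum : HasFDerivAt (fun y => (f y : ℂ)) (∑ ω ∈ Ω, c ω • L ω) x := by
    simp_rw [hc]
    exact HasFDerivAt.fun_sum fun ω _ => (hL ω).const_mul (c ω)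
  -- Taking real parts shows that `f` itself is differentiable; uniqueness of the derivative then
  -- identifies `fderiv ℝ f x` inside `ℂ`.
  have hre : HasFDerivAt f (Complex.reCLM.comp (∑ ω ∈ Ω, c ω • L ω)) x :=
    Complex.reCLM.hasFDerivAt.comp x hsum
  have heq : Complex.ofRealCLM.comp (fderiv ℝ f x) = ∑ ω ∈ Ω, c ω • L ω :=
    (Complex.ofRealCLM.hasFDerivAt.comp x hre.differentiableAt.hasFDerivAt).unique hsum
  calc ((_root_.partialDeriv i f x : ℝ) : ℂ)
      = Complex.ofRealCLM.comp (fderiv ℝ f x) (Pi.single i 1) := rfl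
    _ = _ := by
      rw [heq, sum_apply]
      exact Finset.sum_congr rfl fun ω _ => by simp [hLi, mul_assoc]

theorem multiDeriv (hf : IsRealTrigSum Ω f) (α : Fin N → ℕ) :
    IsRealTrigSum Ω (multiDeriv α f) := by
  unfold _root_.multiDeriv
  induction List.finRange N with
  | nil => exact hf
  | cons i l ih =>
    rw [List.foldr_cons]
    induction α i with
    | zero => exact ih
    | succ m ihm =>
      rw [Function.iterate_succ_apply']
      exact ihm.partialDeriv i

theorem const_mul (hf : IsRealTrigSum Ω f) (s : ℝ) : IsRealTrigSum Ω fun x => s * f x := by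
  obtain ⟨c, hc⟩ := hf
  refine ⟨fun ω => s * c ω, fun x => ?_⟩
  simp only [Complex.ofReal_mul, hc, Finset.mul_sum, mul_assoc]

end IsRealTrigSum

theorem multiDeriv_zero_fun {N : ℕ} (α : Fin N → ℕ) : multiDeriv α (0 : (Fin N → ℝ) → ℝ) = 0 := by
  unfold multiDeriv
  induction List.finRange N with
  | nil => rfl
  | cons i l ih =>
    rw [List.foldr_cons, ih]
    refine Function.iterate_fixed ?_ _
    funext x
    simp [partialDeriv]

theorem zero_mem_trigClass {N : ℕ} (Ω : Finset (Fin N → ℝ)) {B : ℝ} (hB : 0 ≤ B) :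
    0 ∈ trigClass Ω B :=
  ⟨⟨0, by simp⟩, fun _ _ => by simpa using hB⟩

/-! ### The cube and bounds almost everywhere -/

theorem closure_openCube (N : ℕ) : closure (openCube N) = closedCube N := by
  rw [openCube, closedCube, closure_pi_set]
  simp [closure_Ioo Real.two_pi_pos.ne]

theorem isOpen_openCube (N : ℕ) : IsOpen (openCube N) :=
  isOpen_set_pi Set.finite_univ fun _ _ => isOpen_Ioo

/-- The faces are null, so Sobolev regularity on the open cube and loss bounds on the closed one
refer to the same measure. -/
theorem restrict_openCube_eq_restrict_closedCube (N : ℕ) :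
    (volume : Measure (Fin N → ℝ)).restrict (openCube N) = volume.restrict (closedCube N) := by
  refine Measure.restrict_congr_set ?_
  have := Measure.univ_pi_Ioo_ae_eq_Icc (μ := fun _ : Fin N => (volume : Measure ℝ))
    (f := fun _ => 0) (g := fun _ => 2 * Real.pi)
  rwa [← Set.pi_univ_Icc, ← volume_pi] at this

/-- A continuous function that is bounded almost everywhere on the cube is bounded on it. -/
theorem Continuous.abs_le_on_closedCube_of_ae {N : ℕ} {h : (Fin N → ℝ) → ℝ} (hh : Continuous h)
    {C : ℝ} (hC : ∀ᵐ x ∂(volume.restrict (closedCube N)), |h x| ≤ C) :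
    ∀ x ∈ closedCube N, |h x| ≤ C := by
  -- An open null set is empty, which gives the bound on the open cube; continuity carries it to the
  -- closure.
  have hopen : IsOpen ({x | C < |h x|} ∩ openCube N) :=
    (isOpen_lt continuous_const hh.abs).inter (isOpen_openCube N)
  have hnull : volume ({x | C < |h x|} ∩ openCube N) = 0 := by
    rw [← restrict_openCube_eq_restrict_closedCube, ae_iff] at hC
    simp only [not_le] at hC
    rwa [Measure.restrict_apply (isOpen_lt continuous_const hh.abs).measurableSet] at hC
  have hempty := (hopen.measure_eq_zero_iff volume).mp hnull
  have hsub : openCube N ⊆ {x | |h x| ≤ C} := fun x hx => by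
    by_contra hlt
    exact Set.eq_empty_iff_forall_notMem.mp hempty x
      ⟨show C < |h x| from lt_of_not_ge hlt, hx⟩
  have hcl := closure_minimal hsub (isClosed_le hh.abs continuous_const)
  rw [closure_openCube] at hcl
  exact fun x hx => hcl hx

theorem abs_le_sqrt_of_sobolevLoss_le {N k : ℕ} {u v : DerivFamily N} {x : Fin N → ℝ} {c : ℝ}
    (h : sobolevLoss k u v x ≤ c) {α : Fin N → ℕ} (hα : α ∈ multiIndices N k) :
    |u α x - v α x| ≤ √c :=
  Real.abs_le_sqrt ((Finset.single_le_sum (f := fun α => (u α x - v α x) ^ 2)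
    (fun _ _ => sq_nonneg _) hα).trans h)

/-! ### Coefficient bounds -/

noncomputable section

/-- The constant, cosine and sine functions spanning `coeffClass`. -/
def trigBasis {N : ℕ} (Ωplus : Finset (Fin N → ℝ)) :
    Option (Ωplus ⊕ Ωplus) → (Fin N → ℝ) → ℝ
  | none, _ => 1 / 2
  | some (Sum.inl ω), x => Real.cos (ω.1 ⬝ᵥ x)
  | some (Sum.inr ω), x => Real.sin (ω.1 ⬝ᵥ x)

end

theorem abs_trigBasis_le_one {N : ℕ} (Ωplus : Finset (Fin N → ℝ)) (j : Option (Ωplus ⊕ Ωplus))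
    (x : Fin N → ℝ) : |trigBasis Ωplus j x| ≤ 1 := by
  rcases j with _ | ω | ω
  · norm_num [trigBasis, abs_of_pos]
  · exact Real.abs_cos_le_one _
  · exact Real.abs_sin_le_one _

theorem continuous_trigBasis {N : ℕ} (Ωplus : Finset (Fin N → ℝ)) (j : Option (Ωplus ⊕ Ωplus)) :
    Continuous (trigBasis Ωplus j) := by
  have hd : ∀ ω : Fin N → ℝ, Continuous fun x : Fin N → ℝ => ω ⬝ᵥ x := fun ω => by
    unfold dotProduct; fun_prop
  rcases j with _ | ω | ω
  · exact continuous_const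
  · exact Real.continuous_cos.comp (hd ω)
  · exact Real.continuous_sin.comp (hd ω)

/-- Functions in `coeffClass` are combinations of `trigBasis` with coefficients at most `B'`. -/
theorem exists_coeff_of_mem_coeffClass {N : ℕ} {Ωplus : Finset (Fin N → ℝ)} {B' : ℝ}
    {f : (Fin N → ℝ) → ℝ} (hf : f ∈ coeffClass Ωplus B') :
    ∃ θ : Option (Ωplus ⊕ Ωplus) → ℝ,
      (∀ j, |θ j| ≤ B') ∧ ∀ x, f x = ∑ j, θ j * trigBasis Ωplus j x := by
  obtain ⟨a₀, a, b, hfx, hab⟩ := hf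
  have hle : ∀ s : ℝ, s ^ 2 ≤ a₀ ^ 2 + ∑ ω ∈ Ωplus, (a ω ^ 2 + b ω ^ 2) → |s| ≤ B' :=
    fun s hs => (Real.abs_le_sqrt hs).trans hab
  have hmem : ∀ ω ∈ Ωplus, a ω ^ 2 + b ω ^ 2 ≤ ∑ ω ∈ Ωplus, (a ω ^ 2 + b ω ^ 2) :=
    fun ω hω => Finset.single_le_sum (f := fun ω => a ω ^ 2 + b ω ^ 2)
      (fun _ _ => by positivity) hω
  refine ⟨fun j => j.elim a₀ (Sum.elim (fun ω => a ω) (fun ω => b ω)), ?_, fun x => ?_⟩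
  · rintro (_ | ω | ω)
    · exact hle a₀ (le_add_of_nonneg_right (Finset.sum_nonneg fun _ _ => by positivity))
    · exact hle (a ω) (by nlinarith [hmem ω ω.2, sq_nonneg a₀, sq_nonneg (b ω)])
    · exact hle (b ω) (by nlinarith [hmem ω ω.2, sq_nonneg a₀, sq_nonneg (a ω)])
  · rw [hfx, Fintype.sum_option, Fintype.sum_sum_type, Finset.sum_add_distrib,
      ← Finset.sum_coe_sort Ωplus, ← Finset.sum_coe_sort Ωplus]
    simp only [trigBasis, Option.elim, Sum.elim_inl, Sum.elim_inr]
    ring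

/-- The derivatives of functions in `trigClass` inherit the coefficient bound of `coeffClass`, up to
the ratio of the bounds on the values. -/
theorem exists_coeff_multiDeriv {N : ℕ} {Ω Ωplus : Finset (Fin N → ℝ)} {B B' : ℝ} (hB : 0 < B)
    (hsub : trigClass Ω B ⊆ coeffClass Ωplus B') {f : (Fin N → ℝ) → ℝ} (hf : IsRealTrigSum Ω f)
    (α : Fin N → ℕ) {s : ℝ} (hs : 0 < s) (hbound : ∀ x ∈ closedCube N, |multiDeriv α f x| ≤ s) :
    ∃ θ : Option (Ωplus ⊕ Ωplus) → ℝ,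
      (∀ j, |θ j| ≤ s * B' / B) ∧ ∀ x, multiDeriv α f x = ∑ j, θ j * trigBasis Ωplus j x := by
  -- The factor `B / s` turns the bound `s` into `B`; undoing it costs the factor `s / B` on the
  -- coefficients.
  have hmem : (fun x => B / s * multiDeriv α f x) ∈ trigClass Ω B := by
    refine ⟨(hf.multiDeriv α).const_mul (B / s), fun x hx => ?_⟩
    rw [abs_mul, abs_of_pos (div_pos hB hs)]
    calc B / s * |multiDeriv α f x| ≤ B / s * s := by gcongr; exact hbound x hx
      _ = B := by field_simp
  obtain ⟨θ, hθ, hθx⟩ := exists_coeff_of_mem_coeffClass (hsub hmem)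
  refine ⟨fun j => s / B * θ j, fun j => ?_, fun x => ?_⟩
  · rw [abs_mul, abs_of_pos (div_pos hs hB), mul_div_right_comm]
    exact mul_le_mul_of_nonneg_left (hθ j) (by positivity)
  · have h := hθx x
    simp only [mul_assoc, ← Finset.mul_sum]
    rw [← h]
    field_simp

theorem HasBoundedDensity.absolutelyContinuous {N : ℕ} {P : Measure (Fin N → ℝ)}
    (hP : HasBoundedDensity P) : P ≪ volume.restrict (closedCube N) := by
  obtain ⟨p, -, -, -, rfl⟩ := hP
  exact withDensity_absolutelyContinuous _ _

/-! ### The rate -/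

noncomputable section

/-- The uniform deviation of the empirical means of all products of the (at most `2n + 2`) functions
in terms of which the `ξ` summands of the loss are quadratic. -/
def momentDeviation (n ξ : ℕ) (c : ℝ) (I : ℕ) (δ : ℝ) : ℝ :=
  √(ξ * (2 * n + 2) ^ 2 * ((√c + 1) ^ 2) ^ 2 / (I * δ))

/-- The rate of the generalization bound. -/
def generalizationRate (n ξ : ℕ) (B B' c : ℝ) (I : ℕ) (δ : ℝ) : ℝ :=
  √(ξ * (momentDeviation n ξ c I δ * ((2 * n + 2) * (1 + (√c + 1) * B' / B)) ^ 2))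

end

/-- The moment deviation is of order `I^(-1/2)`; the outer square root makes the rate of order
`I^(-1/4)`. -/
theorem tendsto_generalizationRate (n ξ : ℕ) (B B' c : ℝ) {δ : ℝ} (hδ : 0 < δ) :
    Tendsto (fun I : ℕ => generalizationRate n ξ B B' c I δ) atTop (𝓝 0) := by
  have h1 : Tendsto (fun I : ℕ => (I : ℝ) * δ) atTop atTop :=
    tendsto_natCast_atTop_atTop.atTop_mul_const hδ
  have h2 : Tendsto (fun I : ℕ => momentDeviation n ξ c I δ) atTop (𝓝 0) := by
    have := (h1.const_div_atTop (ξ * (2 * n + 2) ^ 2 * ((√c + 1) ^ 2) ^ 2)).sqrt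
    rwa [Real.sqrt_zero] at this
  have h3 := ((h2.mul_const (((2 * n + 2) * (1 + (√c + 1) * B' / B)) ^ 2)).const_mul (ξ : ℝ)).sqrt
  rwa [zero_mul, mul_zero, Real.sqrt_zero] at h3

/-- `momentDeviation` is the threshold at which Chebyshev's bound, summed over `ξ (2n+2)²` products
bounded by `(√c+1)²`, equals `δ`. -/
theorem card_mul_div_momentDeviation_sq_le {n ξ m I : ℕ} {c δ : ℝ} (hξ : 0 < ξ) (hI : 1 ≤ I)
    (hδ : 0 < δ) (hm : m ≤ 2 * n + 2) :
    ((ξ * (m * m) : ℕ) : ℝ) * (((√c + 1) ^ 2) ^ 2 / (I * momentDeviation n ξ c I δ ^ 2)) ≤ δ := by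
  have hI0 : (0 : ℝ) < I := by exact_mod_cast hI
  have hξ0 : (0 : ℝ) < ξ := by exact_mod_cast hξ
  have hm0 : (m : ℝ) ≤ 2 * n + 2 := by exact_mod_cast hm
  have hs : 0 < √c + 1 := by positivity
  rw [momentDeviation, Real.sq_sqrt (by positivity)]
  have h1 : ((√c + 1) ^ 2) ^ 2
      / (I * (ξ * (2 * n + 2) ^ 2 * ((√c + 1) ^ 2) ^ 2 / (I * δ))) = δ / (ξ * (2 * n + 2) ^ 2) := by
    field_simp
  rw [h1]
  push_cast
  calc (ξ : ℝ) * (m * m) * (δ / (ξ * (2 * n + 2) ^ 2))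
      ≤ ξ * ((2 * n + 2) * (2 * n + 2)) * (δ / (ξ * (2 * n + 2) ^ 2)) := by gcongr
    _ = δ := by field_simp

/-! ### The target joined to the trigonometric system, and the theorem -/

noncomputable section

/-- A target function together with the functions spanning `coeffClass`. -/
def targetTrigSystem {N : ℕ} (Ωplus : Finset (Fin N → ℝ)) (u : (Fin N → ℝ) → ℝ) :
    Option (Option (Ωplus ⊕ Ωplus)) → (Fin N → ℝ) → ℝ :=
  fun j => j.elim u (trigBasis Ωplus)

end

theorem sub_eq_sum_targetTrigSystem {N : ℕ} {Ωplus : Finset (Fin N → ℝ)} {u h : (Fin N → ℝ) → ℝ}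
    {θ : Option (Ωplus ⊕ Ωplus) → ℝ} (hθ : ∀ x, h x = ∑ j, θ j * trigBasis Ωplus j x)
    (x : Fin N → ℝ) :
    u x - h x = ∑ j, j.elim 1 (fun l => -θ l) * targetTrigSystem Ωplus u j x := by
  rw [hθ, Fintype.sum_option]
  simp [targetTrigSystem, sub_eq_add_neg]

theorem aestronglyMeasurable_targetTrigSystem {N : ℕ} (Ωplus : Finset (Fin N → ℝ))
    {u : (Fin N → ℝ) → ℝ} {P : Measure (Fin N → ℝ)} (hu : AEStronglyMeasurable u P)
    (j : Option (Option (Ωplus ⊕ Ωplus))) :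
    AEStronglyMeasurable (targetTrigSystem Ωplus u j) P := by
  cases j with
  | none => exact hu
  | some l => exact (continuous_trigBasis Ωplus l).aestronglyMeasurable

theorem abs_targetTrigSystem_le {N : ℕ} (Ωplus : Finset (Fin N → ℝ)) {u : (Fin N → ℝ) → ℝ}
    {s : ℝ} (hs : 1 ≤ s) {x : Fin N → ℝ} (hu : |u x| ≤ s) (j : Option (Option (Ωplus ⊕ Ωplus))) :
    |targetTrigSystem Ωplus u j x| ≤ s := by
  cases j with
  | none => exact hu
  | some l => exact (abs_trigBasis_le_one Ωplus l x).trans hs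

theorem sqrt_add_le_sqrt_add_sqrt {a b : ℝ} (ha : 0 ≤ a) (hb : 0 ≤ b) : √(a + b) ≤ √a + √b := by
  refine Real.sqrt_le_iff.mpr ⟨by positivity, ?_⟩
  rw [add_sq, Real.sq_sqrt ha, Real.sq_sqrt hb]
  have : 0 ≤ 2 * √a * √b := by positivity
  linarith

theorem card_frequency_plus_le {N : ℕ} {Ω Ωplus Ωminus : Finset (Fin N → ℝ)}
    (h : IsFrequencySplit Ω Ωplus Ωminus) : Ωplus.card ≤ Ω.card :=
  Finset.card_le_card fun ω hω => (h.1 ω).mpr (Or.inl hω)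

theorem theorem5 :
    -- `r` takes the arguments `|Ω|, ξ, B, B', c, I, δ`
    ∃ r : ℕ → ℕ → ℝ → ℝ → ℝ → ℕ → ℝ → ℝ,
      (∀ (n ξ : ℕ) (B B' c δ : ℝ), 0 < B → 0 < B' → 0 < δ → δ < 1 →
        Tendsto (fun I : ℕ => r n ξ B B' c I δ) atTop (𝓝 0)) ∧
      ∀ (N k : ℕ) (P : Measure (Fin N → ℝ)), IsProbabilityMeasure P → HasBoundedDensity P →
      ∀ (Ω Ωplus Ωminus : Finset (Fin N → ℝ)), IsFrequencySplit Ω Ωplus Ωminus →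
      ∀ (B B' c : ℝ), 0 < B → 0 < B' → trigClass Ω B ⊆ coeffClass Ωplus B' →
      ∀ 𝓕 : Set (DerivFamily N), (∀ u ∈ 𝓕, MemSobolev k u) →
      (∀ u ∈ classicalFamily '' trigClass Ω B ∪ 𝓕, ∀ v ∈ classicalFamily '' trigClass Ω B ∪ 𝓕,
        ∀ᵐ x ∂(volume.restrict (closedCube N)), sobolevLoss k u v x ≤ c) →
      ∀ fstar ∈ 𝓕, ∀ δ : ℝ, 0 < δ → δ < 1 → ∀ I : ℕ, 1 ≤ I →
      -- an event `G` of probability at least `1 - δ` on which the bound holds for all `f` at once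
      ∃ G : Set (Fin I → Fin N → ℝ), MeasurableSet G ∧
        ENNReal.ofReal (1 - δ) ≤ (Measure.pi fun _ : Fin I => P) G ∧
        ∀ S ∈ G, ∀ f ∈ trigClass Ω B,
          sobolevDist k P fstar (classicalFamily f)
            ≤ empiricalSobolevDist k S fstar (classicalFamily f)
              + r Ω.card (multiIndices N k).card B B' c I δ := by
  refine ⟨generalizationRate, fun n ξ B B' c δ _ _ hδ _ =>
    tendsto_generalizationRate n ξ B B' c hδ, ?_⟩
  intro N k P hPprob hP Ω Ωplus Ωminus hΩ B B' c hB hB' hsub 𝓕 h𝓕 hloss u hu δ hδ _ I hI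
  -- The added 1 lets one constant bound both the target and the cosines and sines, and keeps the
  -- rescaling by `B / (√c + 1)` meaningful when `√c = 0`.
  have hs : 1 ≤ √c + 1 := by linarith [Real.sqrt_nonneg c]
  have hs0 : 0 < √c + 1 := by linarith
  have hξ : 0 < (multiIndices N k).card :=
    Finset.card_pos.mpr ⟨0, mem_multiIndices.mpr (by simp)⟩
  have hI0 : (0 : ℝ) < I := by exact_mod_cast hI
  set n := Ω.card
  set ξ := (multiIndices N k).card
  set t := momentDeviation n ξ c I δ with ht_def
  have ht : 0 < t := Real.sqrt_pos.mpr (by positivity)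
  have hzero : classicalFamily (0 : (Fin N → ℝ) → ℝ) ∈ classicalFamily '' trigClass Ω B ∪ 𝓕 :=
    Or.inl ⟨0, zero_mem_trigClass Ω hB.le, rfl⟩
  have hbound : ∀ v ∈ classicalFamily '' trigClass Ω B ∪ 𝓕, ∀ α ∈ multiIndices N k,
      ∀ᵐ x ∂(volume.restrict (closedCube N)), |v α x| ≤ √c + 1 := by
    intro v hv α hα
    filter_upwards [hloss v hv _ hzero] with x hx
    have := abs_le_sqrt_of_sobolevLoss_le hx hα
    simp only [classicalFamily, multiDeriv_zero_fun, Pi.zero_apply, sub_zero] at this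
    linarith
  have hu_meas : ∀ α ∈ multiIndices N k, AEStronglyMeasurable (u α) P := fun α hα => by
    have := (h𝓕 u hu α hα).1.1
    rw [restrict_openCube_eq_restrict_closedCube] at this
    exact this.mono_ac hP.absolutelyContinuous
  have hu_bound : ∀ α ∈ multiIndices N k, ∀ᵐ x ∂P, |u α x| ≤ √c + 1 := fun α hα =>
    hP.absolutelyContinuous.ae_le (hbound u (Or.inr hu) α hα)
  let J := Option (Option (Ωplus ⊕ Ωplus))
  -- These products depend on the target but not on `f`, so the event can be fixed before `f`.
  let F : multiIndices N k × J × J → (Fin N → ℝ) → ℝ := fun q x =>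
    targetTrigSystem Ωplus (u q.1) q.2.1 x * targetTrigSystem Ωplus (u q.1) q.2.2 x
  have hF : ∀ q, AEStronglyMeasurable (F q) P := fun q =>
    (aestronglyMeasurable_targetTrigSystem Ωplus (hu_meas _ q.1.2) _).mul
      (aestronglyMeasurable_targetTrigSystem Ωplus (hu_meas _ q.1.2) _)
  have hFM : ∀ q, ∀ᵐ x ∂P, |F q x| ≤ (√c + 1) ^ 2 := fun q => by
    filter_upwards [hu_bound _ q.1.2] with x hx
    rw [abs_mul, sq]
    exact mul_le_mul (abs_targetTrigSystem_le Ωplus hs hx _)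
      (abs_targetTrigSystem_le Ωplus hs hx _) (abs_nonneg _) hs0.le
  have hJ : Fintype.card J ≤ 2 * n + 2 := by
    have := card_frequency_plus_le hΩ
    simp only [J, Fintype.card_option, Fintype.card_sum, Fintype.card_coe]
    omega
  have hcard : (Fintype.card (multiIndices N k × J × J) : ℝ)
      * (((√c + 1) ^ 2) ^ 2 / (I * t ^ 2)) ≤ δ := by
    rw [Fintype.card_prod, Fintype.card_prod, Fintype.card_coe]
    exact card_mul_div_momentDeviation_sq_le hξ hI hδ hJ
  obtain ⟨G, hGmeas, hGP, hG⟩ := exists_event_empirical_mean_deviation_le P hF hFM hI ht hcard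
  refine ⟨G, hGmeas, hGP, fun S hS f hf => ?_⟩
  have hR : 0 ≤ (√c + 1) * B' / B := by positivity
  have hterm : ∀ α ∈ multiIndices N k, ∫ x, (u α x - multiDeriv α f x) ^ 2 ∂P
      ≤ 1 / (I : ℝ) * ∑ i, (u α (S i) - multiDeriv α f (S i)) ^ 2
        + t * ((2 * n + 2) * (1 + (√c + 1) * B' / B)) ^ 2 := by
    intro α hα
    have hft : IsRealTrigSum Ω f := hf.1
    obtain ⟨θ, hθ, hθx⟩ := exists_coeff_multiDeriv hB hsub hft α hs0
      ((hft.multiDeriv α).continuous.abs_le_on_closedCube_of_ae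
        (hbound _ (Or.inl ⟨f, hf, rfl⟩) α hα))
    simp_rw [sub_eq_sum_targetTrigSystem hθx]
    -- The target enters with coefficient 1, the trigonometric functions with `-θ l`; the sum of the
    -- two bounds covers both.
    have hη : ∀ j : J, |j.elim 1 (fun l => -θ l)| ≤ 1 + (√c + 1) * B' / B := by
      rintro (_ | l)
      · simpa using hR
      · simpa using (hθ l).trans (le_add_of_nonneg_left zero_le_one)
    have hint : ∀ j l : J, Integrable (fun x =>
        targetTrigSystem Ωplus (u α) j x * targetTrigSystem Ωplus (u α) l x) P :=
      fun j l => Integrable.of_bound (hF (⟨α, hα⟩, j, l)) _ (hFM (⟨α, hα⟩, j, l))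
    refine (integral_sq_sum_le_empirical_mean P hint hη S
      fun j l => hG S hS (⟨α, hα⟩, j, l)).trans ?_
    · have : (Fintype.card J : ℝ) ≤ 2 * n + 2 := by exact_mod_cast hJ
      gcongr
  have hsum : ∑ α ∈ multiIndices N k, ∫ x, (u α x - multiDeriv α f x) ^ 2 ∂P
      ≤ 1 / (I : ℝ) * ∑ i, sobolevLoss k u (classicalFamily f) (S i)
        + ξ * (t * ((2 * n + 2) * (1 + (√c + 1) * B' / B)) ^ 2) := by
    refine (Finset.sum_le_sum hterm).trans_eq ?_
    rw [Finset.sum_add_distrib, ← Finset.mul_sum, Finset.sum_comm, Finset.sum_const, nsmul_eq_mul]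
    rfl
  refine (Real.sqrt_le_sqrt hsum).trans (sqrt_add_le_sqrt_add_sqrt ?_ ?_)
  · exact mul_nonneg (by positivity) (Finset.sum_nonneg fun i _ =>
      Finset.sum_nonneg fun α _ => sq_nonneg _)
  · positivity
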